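/- **Theorem (Kolmogorov–Weierstrass).** Let $d\ge 1$ be an integer and let $\alpha\in(0,1)$. Call real numbers $\lambda_1,\dots,\lambda_d$ together with functions $\phi_0,\dots,\phi_{2d}:[0,1]\to[0,1]$ a *Kolmogorov system* with exponent $\alpha$ if $0<\lambda_i\le 1$ for all $i$, every $\phi_q$ is strictly increasing and $\alpha$-Hölder continuous, and for every $f\in C([0,1]^d)$ there is $g\in C([0,d])$ with $$f(x_1,\dots,x_d)=\sum_{q=0}^{2d} g\Big(\sum_{i=1}^d\lambda_i\phi_q(x_i)\Big)\qquad\text{for all }(x_1,\dots,x_d)\in[0,1]^d .$$ For $n\ge 0$ define the Kolmogorov monomial of such a system by $$Kp_n(x_1,\dots,x_d)=\sum_{q=0}^{2d}\Big(\sum_{i=1}^d\lambda_i\phi_q(x_i)\Big)^n .$$ Then a Kolmogorov system with exponent $\alpha$ exists, and for every Kolmogorov system with exponent $\alpha$, every $f\in C([0,1]^d)$ and every $\epsilon>0$ there is a (finite, real) linear combination $K\in\operatorname{span}\{Kp_n\}_{n\ge 0}$ such that $$\|f-K\|_\infty\le\epsilon ,$$ where $\|\cdot\|_\infty$ is the supremum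 norm on $[0,1]^d$. -/

import Mathlib

open scoped NNReal unitInterval

/-- The continuous function `x ↦ ∑ i, lam i * φ_q (x i)` on the cube `[0,1]^d`. -/
noncomputable def kolmogorovInner {d : ℕ} (lam : Fin d → ℝ)
    (φ : Fin (2 * d + 1) → C(I, I)) (q : Fin (2 * d + 1)) : C(Fin d → I, ℝ) where
  toFun x := ∑ i, lam i * (φ q (x i) : ℝ)
  continuous_toFun := by fun_prop

/-- Coefficients `lam` and inner functions `φ_0, …, φ_{2d}` as in Lorentz's version of the
Kolmogorov superposition theorem, with Hölder exponent `α`. -/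
structure IsKolmogorovSystem {d : ℕ} (α : ℝ≥0) (lam : Fin d → ℝ)
    (φ : Fin (2 * d + 1) → C(I, I)) : Prop where
  lam_pos : ∀ i, 0 < lam i
  lam_le_one : ∀ i, lam i ≤ 1
  strictMono : ∀ q, StrictMono (φ q)
  holder : ∀ q, ∃ C : ℝ≥0, HolderWith C α (φ q)
  /-- Every continuous function on the cube is a superposition with one continuous outer
  function `g` on `[0,d]`. -/
  superposition : ∀ f : C(Fin d → I, ℝ), ∃ g : ℝ → ℝ, ContinuousOn g (Set.Icc 0 (d : ℝ)) ∧
    ∀ x, f x = ∑ q, g (kolmogorovInner lam φ q x)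

/-- The Kolmogorov monomial `Kp_n(x) = ∑_q (∑ i, lam i * φ_q (x i)) ^ n`. -/
noncomputable def kolmogorovMonomial {d : ℕ} (lam : Fin d → ℝ)
    (φ : Fin (2 * d + 1) → C(I, I)) (n : ℕ) : C(Fin d → I, ℝ) where
  toFun x := ∑ q, (kolmogorovInner lam φ q x) ^ n
  continuous_toFun := by fun_prop

/-! Density is Weierstrass: approximate the outer function `g` of `f` on $[0,d]$ by a polynomial $p$
within $\epsilon/(2d+1)$; then $\sum_q p(\cdot)$ of the inner sums is a combination of the
monomials.

Existence is a Baire category argument. Put $m=2d+1$ and take weights $\mu_q\lambda_i$ linearly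
independent over $\mathbb Q$. It suffices that for some inner tuple $\psi$ every $f$ admits $g$ with
$\|g\|\le\|f\|$ and $\|f-\sum_q g\circ Y_q\|\le\theta\|f\|$, $\theta<1$: iterating on the residual
makes the superposition operator onto (`surjective_of_approx`).

For one $f$ such a tuple lies near any admissible one (`exists_isAdmissible_superpose`). Precompose
each $\psi_q$ with a fine staircase, the climbing intervals being shifted with $q$ so that a
coordinate is on a climb for at most one $q$. At a point $x$ at least $m-d$ indices then see only
grid values; independence makes the weighted sums of grid values distinct, so $g$ may equal $f/m$
there. The at most $d$ bad indices cost $2\|f\|/m$ each, and $2d/m<1$.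

The conditions are open, and a dense sequence of $f$ suffices, so Baire yields one tuple for all
$f$. Admissibility is not closed, so Baire runs in the closure; strict monotonicity is recovered as
a generic property. -/

open BoundedContinuousFunction

/-! ### Functional-analytic tools. -/

/-- Baire's theorem in the closure of a set `S`: countably many open sets, each of which meets `S`
densely, have a common point in the closure of `S`. -/
theorem exists_mem_closure_inter_of_isOpen {E ι : Type*} [MetricSpace E] [CompleteSpace E]
    [Countable ι] {S : Set E} (hS : S.Nonempty) {U : ι → Set E} (hU : ∀ n, IsOpen (U n))
    (hd : ∀ n, S ⊆ closure (S ∩ U n)) : ∃ x ∈ closure S, ∀ n, x ∈ U n := by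
  have : CompleteSpace (closure S) := isClosed_closure.completeSpace_coe
  have : Nonempty (closure S) := hS.closure.to_subtype
  have key : Dense (⋂ n, ((↑) : closure S → E) ⁻¹' U n) := by
    refine dense_iInter_of_isOpen (fun n => (hU n).preimage continuous_subtype_val) fun n => ?_
    rw [Subtype.dense_iff]
    have h1 : S ∩ U n ⊆ (↑) '' (((↑) : closure S → E) ⁻¹' U n) :=
      fun x hx => ⟨⟨x, subset_closure hx.1⟩, hx.2, rfl⟩
    exact closure_minimal ((hd n).trans (closure_mono h1)) isClosed_closure
  obtain ⟨x, hx⟩ := key.nonempty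
  exact ⟨x, x.2, fun n => Set.mem_iInter.1 hx n⟩

/-- A continuous linear map that solves every equation up to a fixed relative error is onto. -/
theorem ContinuousLinearMap.surjective_of_approx {E F : Type*} [NormedAddCommGroup E]
    [NormedSpace ℝ E] [CompleteSpace E] [NormedAddCommGroup F] [NormedSpace ℝ F]
    (T : E →L[ℝ] F) {θ : ℝ} (hθ0 : 0 ≤ θ) (hθ : θ < 1)
    (h : ∀ f, ∃ g, ‖g‖ ≤ ‖f‖ ∧ ‖f - T g‖ ≤ θ * ‖f‖) : Function.Surjective T := by
  intro f
  choose G hG1 hG2 using h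
  let r : ℕ → F := fun n => Nat.rec f (fun _ x => x - T (G x)) n
  have hr : ∀ n, r (n + 1) = r n - T (G (r n)) := fun n => rfl
  have hb : ∀ n, ‖r n‖ ≤ θ ^ n * ‖f‖ := by
    intro n
    induction n with
    | zero => simp [r]
    | succ n ih =>
      rw [hr, pow_succ']
      calc _ ≤ θ * ‖r n‖ := hG2 _
        _ ≤ θ * (θ ^ n * ‖f‖) := by gcongr
        _ = _ := by ring
  have hsum : Summable fun n => G (r n) :=
    .of_norm_bounded ((summable_geometric_of_lt_one hθ0 hθ).mul_right ‖f‖)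
      fun n => (hG1 _).trans (hb n)
  have hpart : ∀ n, T (∑ k ∈ Finset.range n, G (r k)) = f - r n := by
    intro n
    induction n with
    | zero => simp [r]
    | succ n ih => rw [Finset.sum_range_succ, map_add, ih, hr]; abel
  have hr0 : Filter.Tendsto r Filter.atTop (nhds 0) := by
    refine squeeze_zero_norm hb ?_
    simpa using (tendsto_pow_atTop_nhds_zero_of_lt_one hθ0 hθ).mul_const ‖f‖
  refine ⟨∑' n, G (r n), tendsto_nhds_unique
    ((T.continuous.tendsto _).comp hsum.hasSum.tendsto_sum_nat) ?_⟩
  simpa [Function.comp_def, hpart] using hr0.const_sub f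

/-- Tietze extension from a finite set, viewed as a closed embedded discrete space. -/
theorem exists_boundedContinuousFunction_eq_of_injective {ι : Type*} [Fintype ι] {y : ι → ℝ}
    (hy : Function.Injective y) (v : ι → ℝ) {M : ℝ} (hM : 0 ≤ M) (hv : ∀ i, |v i| ≤ M) :
    ∃ g : ℝ →ᵇ ℝ, ‖g‖ ≤ M ∧ ∀ i, g (y i) = v i := by
  let _ : TopologicalSpace ι := ⊥
  have : DiscreteTopology ι := ⟨rfl⟩
  obtain ⟨g, hg, hgv⟩ := exists_extension_norm_eq_of_isClosedEmbedding
    (BoundedContinuousFunction.mkOfCompact ⟨v, continuous_of_discreteTopology⟩)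
    ((continuous_of_discreteTopology (f := y)).isClosedEmbedding hy)
  refine ⟨g, ?_, fun i => congrFun hgv i⟩
  rw [hg, BoundedContinuousFunction.norm_le hM]
  exact hv

/-! ### Rationally independent weights. -/

theorem exists_transcendental_mem_Ioo : ∃ t : ℝ, 0 < t ∧ t < 1 ∧ Transcendental ℚ t := by
  obtain ⟨t, ht, h0, h1⟩ := ((Algebraic.countable ℚ ℝ).dense_compl ℝ).exists_between
    (zero_lt_one (α := ℝ))
  exact ⟨t, h0, h1, ht⟩

theorem Transcendental.linearIndependent_pow_rat {t : ℝ} (ht : Transcendental ℚ t) :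
    LinearIndependent ℚ fun n : ℕ => t ^ n := by
  have h := (Polynomial.basisMonomials ℚ).linearIndependent.map' (Polynomial.aeval t).toLinearMap
    (LinearMap.ker_eq_bot.2 (transcendental_iff_injective.1 ht))
  have e : (fun n : ℕ => t ^ n) =
      (Polynomial.aeval t).toLinearMap ∘ Polynomial.basisMonomials ℚ := by
    ext n
    simp [Polynomial.coe_basisMonomials, Polynomial.aeval_monomial]
  rw [e]
  exact h

/-- The products are powers $t^{dq+i}$ of one transcendental $t$, and the exponents are distinct by
division by $d$. The product form later lets $\mu_q$ be absorbed into the inner function. -/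
theorem exists_linearIndependent_mul (m d : ℕ) :
    ∃ (μ : Fin m → ℝ) (lam : Fin d → ℝ), (∀ q, 0 < μ q ∧ μ q ≤ 1) ∧
      (∀ i, 0 < lam i ∧ lam i ≤ 1) ∧
      LinearIndependent ℚ fun p : Fin m × Fin d => μ p.1 * lam p.2 := by
  obtain ⟨t, h0, h1, ht⟩ := exists_transcendental_mem_Ioo
  refine ⟨fun q => t ^ (d * q.val), fun i => t ^ i.val,
    fun q => ⟨pow_pos h0 _, pow_le_one₀ h0.le h1.le⟩,
    fun i => ⟨pow_pos h0 _, pow_le_one₀ h0.le h1.le⟩, ?_⟩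
  have h := ht.linearIndependent_pow_rat.comp
    (fun p : Fin m × Fin d => (finProdFinEquiv p).val)
    (Fin.val_injective.comp finProdFinEquiv.injective)
  convert h using 1
  ext p
  simp [pow_add, mul_comm]

/-! ### Density of the Kolmogorov monomials. -/

theorem exists_mem_span_kolmogorovMonomial {d : ℕ} {α : ℝ≥0} {lam : Fin d → ℝ}
    {φ : Fin (2 * d + 1) → C(I, I)} (h : IsKolmogorovSystem α lam φ)
    (f : C(Fin d → I, ℝ)) {ε : ℝ} (hε : 0 < ε) :
    ∃ K ∈ Submodule.span ℝ (Set.range (kolmogorovMonomial lam φ)), ‖f - K‖ ≤ ε := by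
  obtain ⟨g, hg, hfg⟩ := h.superposition f
  have hm : (0 : ℝ) < 2 * d + 1 := by positivity
  obtain ⟨p, hp⟩ := exists_polynomial_near_of_continuousOn 0 d g hg (ε / (2 * d + 1)) (by positivity)
  refine ⟨∑ n ∈ p.support, p.coeff n • kolmogorovMonomial lam φ n,
    Submodule.sum_mem _ fun n _ => Submodule.smul_mem _ _ (Submodule.subset_span ⟨n, rfl⟩), ?_⟩
  rw [ContinuousMap.norm_le _ hε.le]
  intro x
  have hK : (∑ n ∈ p.support, p.coeff n • kolmogorovMonomial lam φ n) x
      = ∑ q, p.eval (kolmogorovInner lam φ q x) := by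
    simp only [ContinuousMap.sum_apply, ContinuousMap.smul_apply, kolmogorovMonomial,
      ContinuousMap.coe_mk, smul_eq_mul, Finset.mul_sum, Polynomial.eval_eq_sum, Polynomial.sum]
    exact Finset.sum_comm
  have hval : ∀ q, kolmogorovInner lam φ q x = ∑ i, lam i * (φ q (x i) : ℝ) := fun _ => rfl
  have hmem : ∀ q, kolmogorovInner lam φ q x ∈ Set.Icc (0 : ℝ) d := by
    intro q
    rw [hval]
    refine ⟨Finset.sum_nonneg fun i _ => mul_nonneg (h.lam_pos i).le (φ q (x i)).2.1, ?_⟩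
    calc _ ≤ ∑ _i : Fin d, (1 : ℝ) := Finset.sum_le_sum fun i _ =>
          mul_le_one₀ (h.lam_le_one i) (φ q (x i)).2.1 (φ q (x i)).2.2
      _ = d := by simp
  rw [ContinuousMap.sub_apply, hfg, hK, ← Finset.sum_sub_distrib]
  calc _ ≤ ∑ q : Fin (2 * d + 1), ε / (2 * d + 1) := by
        refine norm_sum_le_of_le _ fun q _ => ?_
        rw [norm_sub_rev]
        exact (hp _ (hmem q)).le
    _ = ε := by
        rw [Finset.sum_const, Finset.card_univ, Fintype.card_fin, nsmul_eq_mul]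
        push_cast
        field_simp

/-! ### Staircase functions on the line. -/

/-- The staircase function that climbs one unit on `[k m, k m + 1]` and is constant on
`[k m + 1, (k + 1) m]` for every integer `k`. -/
noncomputable def staircase (m : ℕ) (u : ℝ) : ℝ :=
  ⌊u / m⌋ + min (u - m * ⌊u / m⌋) 1

section staircase
variable {m : ℕ}

theorem sub_mul_floor_div_mem (hm : 1 ≤ m) (u : ℝ) :
    0 ≤ u - m * ⌊u / m⌋ ∧ u - m * ⌊u / m⌋ < m := by
  have hm' : (0 : ℝ) < m := by exact_mod_cast hm
  have h1 := Int.floor_le (u / m)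
  have h2 := Int.lt_floor_add_one (u / m)
  rw [le_div_iff₀ hm'] at h1
  rw [div_lt_iff₀ hm'] at h2
  constructor <;> nlinarith

theorem staircase_le_and_sub_le (hm : 1 ≤ m) {u v : ℝ} (h : u ≤ v) :
    staircase m u ≤ staircase m v ∧ staircase m v - staircase m u ≤ v - u := by
  have hm' : (1 : ℝ) ≤ m := by exact_mod_cast hm
  obtain ⟨hu0, hu1⟩ := sub_mul_floor_div_mem hm u
  obtain ⟨hv0, hv1⟩ := sub_mul_floor_div_mem hm v
  have hk : ⌊u / m⌋ ≤ ⌊v / m⌋ := Int.floor_le_floor (by gcongr)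
  unfold staircase
  generalize ⌊u / (m : ℝ)⌋ = k at *
  generalize ⌊v / (m : ℝ)⌋ = l at *
  rcases hk.eq_or_lt with rfl | hlt
  · constructor <;>
      rcases min_cases (u - m * k) 1 with ⟨e, _⟩ | ⟨e, _⟩ <;>
      rcases min_cases (v - m * k) 1 with ⟨e', _⟩ | ⟨e', _⟩ <;> rw [e, e'] <;> linarith
  · have hlt' : (k : ℝ) + 1 ≤ l := by exact_mod_cast hlt
    -- The $l-k-1$ whole periods in between each have length $m$ and climb only 1.
    have hmul : 0 ≤ ((l : ℝ) - k - 1) * (m - 1) :=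
      mul_nonneg (by linarith) (by linarith)
    constructor <;>
      rcases min_cases (u - m * k) 1 with ⟨e, _⟩ | ⟨e, _⟩ <;>
      rcases min_cases (v - m * l) 1 with ⟨e', _⟩ | ⟨e', _⟩ <;> rw [e, e'] <;> nlinarith

/-- Within a period, $s/m\le\min(s,1)\le s/m+1$ for $0\le s<m$. -/
theorem staircase_bounds (hm : 1 ≤ m) (u : ℝ) :
    u / m ≤ staircase m u ∧ staircase m u ≤ u / m + 1 := by
  have hm' : (1 : ℝ) ≤ m := by exact_mod_cast hm
  obtain ⟨hu0, hu1⟩ := sub_mul_floor_div_mem hm u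
  have hm0 : (0 : ℝ) < m := by linarith
  rw [div_le_iff₀ hm0, ← sub_le_iff_le_add, le_div_iff₀ hm0]
  unfold staircase
  generalize ⌊u / (m : ℝ)⌋ = k at *
  constructor <;>
    rcases min_cases (u - m * k) 1 with ⟨e, _⟩ | ⟨e, _⟩ <;> rw [e] <;> nlinarith

theorem staircase_cast (m : ℕ) (u : ℚ) :
    staircase m (u : ℝ) = ((⌊u / m⌋ + min (u - m * ⌊u / m⌋) 1 : ℚ) : ℝ) := by
  have h : ⌊(u : ℝ) / m⌋ = ⌊u / m⌋ := by
    rw [← Rat.floor_cast (α := ℝ)]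
    push_cast
    rfl
  rw [staircase, h]
  push_cast
  rfl

/-- The climbing part of a period is exactly where $m$ divides the floor; this turns counting bad
indices into counting residues. -/
theorem staircase_eq_of_floor (hm : 1 ≤ m) (u : ℝ) (h : ¬ (m : ℤ) ∣ ⌊u⌋) :
    staircase m u = ⌊u / m⌋ + 1 := by
  obtain ⟨hu0, hu1⟩ := sub_mul_floor_div_mem hm u
  rw [staircase, min_eq_right]
  by_contra! hlt
  refine h ⟨⌊u / m⌋, Int.floor_eq_iff.2 ⟨?_, ?_⟩⟩ <;> push_cast <;> linarith

end staircase

/-! ### Staircase self-maps of the unit interval. -/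

/-- The `q`-th of `m` shifted staircase self-maps of `[0,1]` with step length `1 / N`. -/
noncomputable def staircaseMap (m N : ℕ) (q : ℕ) (x : I) : I :=
  Set.projIcc 0 1 zero_le_one (staircase m (m * N * x - q) / N)

section staircaseMap
variable {m N q : ℕ}

theorem staircaseMap_monotone (hm : 1 ≤ m) : Monotone (staircaseMap m N q) := by
  intro x y hxy
  refine Set.monotone_projIcc _ ?_
  have : (x : ℝ) ≤ y := hxy
  gcongr
  exact (staircase_le_and_sub_le hm (by gcongr)).1

theorem abs_projIcc_sub_projIcc_le (a b : ℝ) :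
    |(Set.projIcc (0 : ℝ) 1 zero_le_one a : ℝ) - Set.projIcc (0 : ℝ) 1 zero_le_one b| ≤ |a - b| := by
  have := (LipschitzWith.projIcc (zero_le_one (α := ℝ))).dist_le_mul a b
  simpa [Subtype.dist_eq, Real.dist_eq] using this

/-- The constant does not depend on $N$: the factor $mN$ inside is offset by $1/N$ outside. -/
theorem abs_staircaseMap_sub_le (hm : 1 ≤ m) (hN : 1 ≤ N) (x y : I) :
    |(staircaseMap m N q x : ℝ) - staircaseMap m N q y| ≤ m * |(x : ℝ) - y| := by
  wlog hxy : (y : ℝ) ≤ x generalizing x y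
  · rw [abs_sub_comm, abs_sub_comm (x : ℝ)]
    exact this y x (le_of_not_ge hxy)
  have hN' : (0 : ℝ) < N := by exact_mod_cast hN
  refine (abs_projIcc_sub_projIcc_le _ _).trans ?_
  have h := staircase_le_and_sub_le hm
    (show (m : ℝ) * N * y - q ≤ m * N * x - q by gcongr)
  rw [← sub_div, abs_of_nonneg (div_nonneg (by linarith [h.1]) hN'.le),
    abs_of_nonneg (by linarith), div_le_iff₀ hN']
  nlinarith [h.2]

theorem abs_staircaseMap_sub_self_le (hN : 1 ≤ N) (hq : q < m) (x : I) :
    |(staircaseMap m N q x : ℝ) - x| ≤ 1 / N := by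
  have hN' : (0 : ℝ) < N := by exact_mod_cast hN
  have hm : 1 ≤ m := by omega
  have hm' : (0 : ℝ) < m := by exact_mod_cast hm
  have hq' : (q : ℝ) < m := by exact_mod_cast hq
  have hq0 : (q : ℝ) / m < 1 := (div_lt_one hm').2 hq'
  have hq1 : 0 ≤ (q : ℝ) / m := by positivity
  have hx : (x : ℝ) = Set.projIcc (0 : ℝ) 1 zero_le_one (x : ℝ) := by rw [Set.projIcc_val]
  rw [hx]
  refine (abs_projIcc_sub_projIcc_le _ _).trans ?_
  obtain ⟨h1, h2⟩ := staircase_bounds hm (m * N * x - q)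
  have h3 : ((m : ℝ) * N * x - q) / m = N * x - q / m := by field_simp
  rw [h3] at h1 h2
  rw [div_sub' hN'.ne', abs_div, abs_of_pos hN']
  gcongr
  rw [abs_le]
  constructor <;> linarith

theorem staircaseMap_rat (x : I) (hx : (x : ℝ) ∈ Set.range ((↑) : ℚ → ℝ)) :
    (staircaseMap m N q x : ℝ) ∈ Set.range ((↑) : ℚ → ℝ) := by
  obtain ⟨r, hr⟩ := hx
  have h : (m : ℝ) * N * x - q = ((m * N * r - q : ℚ) : ℝ) := by push_cast; rw [hr]
  rw [staircaseMap, h, staircase_cast, Set.coe_projIcc]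
  refine ⟨max 0 (min 1 ((⌊(m * N * r - q : ℚ) / m⌋ +
    min ((m * N * r - q : ℚ) - m * ⌊(m * N * r - q : ℚ) / m⌋) 1) / N)), ?_⟩
  push_cast
  rfl

theorem staircaseMap_mem_grid (hm : 1 ≤ m) (hN : 1 ≤ N) (x : I)
    (h : ¬ (m : ℤ) ∣ ⌊(m : ℝ) * N * x⌋ - q) :
    ∃ j : Fin (N + 1), (staircaseMap m N q x : ℝ) = j / N := by
  have hN' : (0 : ℝ) < N := by exact_mod_cast hN
  have h' : ¬ (m : ℤ) ∣ ⌊(m : ℝ) * N * x - q⌋ := by rwa [Int.floor_sub_natCast]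
  rw [staircaseMap, staircase_eq_of_floor hm _ h', Set.coe_projIcc]
  set k := ⌊((m : ℝ) * N * x - q) / m⌋ + 1 with hk
  have hk' : (⌊((m : ℝ) * N * x - q) / m⌋ : ℝ) + 1 = (k : ℝ) := by rw [hk]; push_cast; rfl
  rw [hk']
  clear_value k
  -- Heights outside $0,\dots,N$ are clamped to the end points of the grid.
  rcases le_total k 0 with h0 | h0
  · refine ⟨0, ?_⟩
    have : (k : ℝ) / N ≤ 0 := div_nonpos_of_nonpos_of_nonneg (by exact_mod_cast h0) hN'.le
    simp [this]
  rcases le_total k N with h1 | h1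
  · lift k to ℕ using h0
    refine ⟨⟨k, by omega⟩, ?_⟩
    have : ((k : ℤ) : ℝ) / N ≤ 1 := (div_le_one hN').2 (by exact_mod_cast h1)
    rw [min_eq_right this, max_eq_right (by positivity)]
    simp
  · refine ⟨Fin.last N, ?_⟩
    have : 1 ≤ (k : ℝ) / N := (one_le_div hN').2 (by exact_mod_cast h1)
    simp [this, hN'.ne']

end staircaseMap

/-! ### Admissible inner functions, stable under tilting and flattening. -/

/-- Monotone Lipschitz functions `[0,1] → [0,1]` with `α`-Hölder constant less than `1` that are
rational at rational points. -/
structure IsAdmissible (α : ℝ≥0) (χ : C(I, ℝ)) : Prop where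
  mono : Monotone χ
  mem_Icc : ∀ x, χ x ∈ Set.Icc (0 : ℝ) 1
  lipschitz : ∃ L : ℝ, 0 ≤ L ∧ ∀ x y : I, |χ x - χ y| ≤ L * |(x : ℝ) - y|
  holder : ∃ C : ℝ, 0 ≤ C ∧ C < 1 ∧ ∀ x y : I, |χ x - χ y| ≤ C * |(x : ℝ) - y| ^ (α : ℝ)
  rat : ∀ x : I, (x : ℝ) ∈ Set.range ((↑) : ℚ → ℝ) → χ x ∈ Set.range ((↑) : ℚ → ℝ)

theorem isAdmissible_zero (α : ℝ≥0) : IsAdmissible α 0 where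
  mono := monotone_const
  mem_Icc _ := by simp
  lipschitz := ⟨0, le_rfl, by simp⟩
  holder := ⟨0, le_rfl, zero_lt_one, by simp⟩
  rat _ _ := ⟨0, by simp⟩

theorem unitInterval.abs_sub_le_one (x y : I) : |(x : ℝ) - y| ≤ 1 :=
  abs_sub_le_iff.2 ⟨by linarith [x.2.2, y.2.1], by linarith [y.2.2, x.2.1]⟩

/-- The convex combination of `χ` with `x ↦ (x + 1) / 2`, with weights `1 - t` and `t`. -/
noncomputable def tilt (t : ℝ) (χ : C(I, ℝ)) : C(I, ℝ) where
  toFun x := (1 - t) * χ x + t * (((x : ℝ) + 1) / 2)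
  continuous_toFun := by fun_prop

theorem tilt_apply (t : ℝ) (χ : C(I, ℝ)) (x : I) :
    tilt t χ x = (1 - t) * χ x + t * (((x : ℝ) + 1) / 2) := rfl

namespace IsAdmissible
variable {α : ℝ≥0} {χ : C(I, ℝ)}

theorem strictMono_tilt (h : IsAdmissible α χ) {t : ℝ} (h0 : 0 < t) (h1 : t ≤ 1) :
    StrictMono (tilt t χ) := by
  intro x y hxy
  have e1 : χ x ≤ χ y := h.mono hxy.le
  have e2 : (x : ℝ) < y := hxy
  rw [tilt_apply, tilt_apply]
  nlinarith [mul_nonneg (sub_nonneg.2 h1) (sub_nonneg.2 e1), mul_pos h0 (sub_pos.2 e2)]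

theorem tilt_pos (h : IsAdmissible α χ) {t : ℝ} (h0 : 0 < t) (h1 : t ≤ 1) (x : I) :
    0 < tilt t χ x := by
  rw [tilt_apply]
  have e := (h.mem_Icc x).1
  have ex := x.2.1
  have : 0 ≤ (1 - t) * χ x := mul_nonneg (by linarith) e
  have : 0 < t * (((x : ℝ) + 1) / 2) := by positivity
  linarith

theorem dist_tilt_le (h : IsAdmissible α χ) {t : ℝ} (h0 : 0 ≤ t) : dist (tilt t χ) χ ≤ t := by
  rw [ContinuousMap.dist_le h0]
  intro x
  obtain ⟨e1, e2⟩ := h.mem_Icc x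
  have ex := x.2
  rw [tilt_apply, Real.dist_eq,
    show (1 - t) * χ x + t * (((x : ℝ) + 1) / 2) - χ x = t * (((x : ℝ) + 1) / 2 - χ x) by ring,
    abs_mul, abs_of_nonneg h0]
  refine mul_le_of_le_one_right h0 (abs_le.2 ⟨?_, ?_⟩) <;> linarith [ex.1, ex.2]

/-- The function $(x+1)/2$ has Hölder constant $1/2$ on $[0,1]$, so the constant stays below 1; a
rational $t$ preserves rational values. -/
theorem tilt_rat (h : IsAdmissible α χ) (hα : α < 1) {t : ℚ} (h0 : 0 < t) (h1 : t ≤ 1) :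
    IsAdmissible α (tilt t χ) := by
  have h0' : (0 : ℝ) < t := by exact_mod_cast h0
  have h1' : (t : ℝ) ≤ 1 := by exact_mod_cast h1
  have hsub : ∀ x y : I, |tilt t χ x - tilt t χ y| ≤
      (1 - t) * |χ x - χ y| + t / 2 * |(x : ℝ) - y| := by
    intro x y
    rw [tilt_apply, tilt_apply, show (1 - (t : ℝ)) * χ x + t * (((x : ℝ) + 1) / 2) -
      ((1 - t) * χ y + t * (((y : ℝ) + 1) / 2)) = (1 - t) * (χ x - χ y) + t / 2 * (x - y) by ring]
    refine (abs_add_le _ _).trans_eq ?_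
    rw [abs_mul, abs_mul, abs_of_nonneg (sub_nonneg.2 h1'),
      abs_of_nonneg (half_pos h0').le]
  refine ⟨(h.strictMono_tilt h0' h1').monotone, fun x => ⟨(h.tilt_pos h0' h1' x).le, ?_⟩, ?_, ?_, ?_⟩
  · rw [tilt_apply]
    have e := (h.mem_Icc x).2
    have ex := x.2.2
    nlinarith
  · obtain ⟨L, hL0, hL⟩ := h.lipschitz
    refine ⟨L + 1, by linarith, fun x y => (hsub x y).trans ?_⟩
    have e1 : (1 - (t : ℝ)) * |χ x - χ y| ≤ L * |(x : ℝ) - y| :=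
      (mul_le_of_le_one_left (abs_nonneg _) (by linarith)).trans (hL x y)
    have e2 : t / 2 * |(x : ℝ) - y| ≤ |(x : ℝ) - y| :=
      mul_le_of_le_one_left (abs_nonneg _) (by linarith)
    linarith
  · obtain ⟨C, hC0, hC1, hC⟩ := h.holder
    refine ⟨(1 - t) * C + t / 2, by nlinarith, by nlinarith, fun x y => (hsub x y).trans ?_⟩
    have e1 : |(x : ℝ) - y| ≤ |(x : ℝ) - y| ^ (α : ℝ) :=
      Real.self_le_rpow_of_le_one (abs_nonneg _) (unitInterval.abs_sub_le_one x y)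
        (by exact_mod_cast hα.le)
    rw [add_mul, mul_assoc]
    have := hC x y
    have : 0 ≤ 1 - (t : ℝ) := by linarith
    gcongr
  · rintro x ⟨r, hr⟩
    obtain ⟨s, hs⟩ := h.rat x ⟨r, hr⟩
    refine ⟨(1 - t) * s + t * ((r + 1) / 2), ?_⟩
    rw [tilt_apply, ← hr, ← hs]
    push_cast
    rfl

end IsAdmissible

theorem continuous_staircaseMap {m N q : ℕ} (hm : 1 ≤ m) (hN : 1 ≤ N) :
    Continuous (staircaseMap m N q) :=
  (LipschitzWith.of_dist_le_mul (K := m) fun x y => by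
    simpa [Subtype.dist_eq, Real.dist_eq] using abs_staircaseMap_sub_le hm hN x y).continuous

/-- Flattening preserves admissibility once the steps are short enough. -/
theorem IsAdmissible.eventually_comp {α : ℝ≥0} {χ : C(I, ℝ)} (h : IsAdmissible α χ) (hα0 : 0 < α)
    (hα1 : α < 1) {m : ℕ} (hm : 1 ≤ m) :
    ∀ᶠ N : ℕ in Filter.atTop, ∀ q (h' : C(I, I)), q < m → ⇑h' = staircaseMap m N q →
      IsAdmissible α (χ.comp h') := by
  obtain ⟨L, hL0, hL⟩ := h.lipschitz
  obtain ⟨C, hC0, hC1, hC⟩ := h.holder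
  have hα0' : (0 : ℝ) < α := by exact_mod_cast hα0
  have hα1' : (α : ℝ) < 1 := by exact_mod_cast hα1
  -- The new Hölder constant is $(1+C)/2$. At distances below $\tau$ the Lipschitz bound $Lm$ gives
  -- it; above $\tau$ the displacement $1/N$ of each point costs at most $\frac{1-C}2\tau^\alpha$
  -- for large $N$.
  have hmid : 0 < (1 + C) / 2 := by linarith
  obtain ⟨τ, hτ0, hτ⟩ : ∃ τ : ℝ, 0 < τ ∧ L * m * τ ^ (1 - α : ℝ) ≤ (1 + C) / 2 := by
    have ht : Filter.Tendsto (fun τ : ℝ => L * m * τ ^ (1 - α : ℝ)) (nhdsWithin 0 (Set.Ioi 0))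
        (nhds 0) := by
      have := ((Real.continuousAt_rpow_const 0 (1 - α : ℝ) (.inr (by linarith))).tendsto.const_mul
        (L * m)).mono_left (nhdsWithin_le_nhds (s := Set.Ioi 0))
      simpa [Real.zero_rpow (sub_pos.2 hα1').ne'] using this
    obtain ⟨τ, h1, h2⟩ :=
      ((ht.eventually (ge_mem_nhds hmid)).and self_mem_nhdsWithin).exists
    exact ⟨τ, h2, h1⟩
  have hN : Filter.Tendsto (fun N : ℕ => C * (2 * (1 / (N : ℝ))) ^ (α : ℝ)) Filter.atTop
      (nhds 0) := by
    have h1 : Filter.Tendsto (fun N : ℕ => 2 * (1 / (N : ℝ))) Filter.atTop (nhds 0) := by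
      simpa using tendsto_one_div_atTop_nhds_zero_nat.const_mul (2 : ℝ)
    have h2 := ((Real.continuousAt_rpow_const 0 (α : ℝ) (.inr hα0'.le)).tendsto.comp h1).const_mul C
    simpa [Real.zero_rpow hα0'.ne', Function.comp_def] using h2
  have hpos : 0 < (1 - C) / 2 * τ ^ (α : ℝ) := mul_pos (by linarith) (Real.rpow_pos_of_pos hτ0 _)
  filter_upwards [hN.eventually (ge_mem_nhds hpos), Filter.eventually_ge_atTop 1]
    with N hN hN1 q h' hq hh'
  have hlip : ∀ x y, |χ (h' x) - χ (h' y)| ≤ L * m * |(x : ℝ) - y| := fun x y => by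
    rw [mul_assoc]
    refine (hL _ _).trans (mul_le_mul_of_nonneg_left ?_ hL0)
    rw [hh']
    exact abs_staircaseMap_sub_le hm hN1 x y
  refine ⟨?_, fun x => h.mem_Icc _, ⟨L * m, by positivity, hlip⟩,
    ⟨(1 + C) / 2, hmid.le, by linarith, fun x y => ?_⟩, fun x hx => h.rat _ ?_⟩
  · intro x y hxy
    simp only [ContinuousMap.comp_apply, hh']
    exact h.mono (staircaseMap_monotone hm hxy)
  · simp only [ContinuousMap.comp_apply]
    have ha := abs_nonneg ((x : ℝ) - y)
    rcases le_total |(x : ℝ) - y| τ with hle | hle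
    · refine (hlip x y).trans ?_
      rcases ha.eq_or_lt with h0 | h0
      · rw [← h0, mul_zero]
        positivity
      calc L * m * |(x : ℝ) - y|
          = L * m * |(x : ℝ) - y| ^ (1 - α : ℝ) * |(x : ℝ) - y| ^ (α : ℝ) := by
            rw [mul_assoc _ (_ ^ _), ← Real.rpow_add h0, sub_add_cancel, Real.rpow_one]
        _ ≤ L * m * τ ^ (1 - α : ℝ) * |(x : ℝ) - y| ^ (α : ℝ) := by
            have : 0 ≤ 1 - (α : ℝ) := by linarith
            gcongr
        _ ≤ _ := by gcongr
    · have hd : |(h' x : ℝ) - h' y| ≤ |(x : ℝ) - y| + 2 * (1 / N) := by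
        have e1 := abs_le.1 (abs_staircaseMap_sub_self_le hN1 hq x)
        have e2 := abs_le.1 (abs_staircaseMap_sub_self_le hN1 hq y)
        have e3 := le_abs_self ((x : ℝ) - y)
        have e4 := neg_abs_le ((x : ℝ) - y)
        rw [hh', abs_le]
        constructor <;> linarith
      calc _ ≤ C * |(h' x : ℝ) - h' y| ^ (α : ℝ) := hC _ _
        _ ≤ C * (|(x : ℝ) - y| + 2 * (1 / N)) ^ (α : ℝ) := by gcongr
        _ ≤ C * (|(x : ℝ) - y| ^ (α : ℝ) + (2 * (1 / N)) ^ (α : ℝ)) := by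
            gcongr
            exact Real.rpow_add_le_add_rpow ha (by positivity) hα0'.le hα1'.le
        _ ≤ C * |(x : ℝ) - y| ^ (α : ℝ) + (1 - C) / 2 * τ ^ (α : ℝ) := by
            rw [mul_add]
            gcongr
        _ ≤ C * |(x : ℝ) - y| ^ (α : ℝ) + (1 - C) / 2 * |(x : ℝ) - y| ^ (α : ℝ) := by
            have : 0 ≤ (1 - C) / 2 := by linarith
            gcongr
        _ = _ := by ring
  · rw [hh']
    exact staircaseMap_rat x hx

/-! ### Superpositions and one approximation step. -/

/-- The function `x ↦ ∑ i, w i * χ (x i)` on the cube. -/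
noncomputable def weightedSum {d : ℕ} (w : Fin d → ℝ) (χ : C(I, ℝ)) : C(Fin d → I, ℝ) where
  toFun x := ∑ i, w i * χ (x i)
  continuous_toFun := by fun_prop

theorem weightedSum_apply {d : ℕ} (w : Fin d → ℝ) (χ : C(I, ℝ)) (x : Fin d → I) :
    weightedSum w χ x = ∑ i, w i * χ (x i) := rfl

theorem continuous_weightedSum {d : ℕ} (w : Fin d → ℝ) : Continuous (weightedSum w) := by
  have h : weightedSum w = fun χ => ∑ i, w i • χ.comp ⟨fun x : Fin d → I => x i, by fun_prop⟩ := by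
    ext χ x
    simp [weightedSum_apply]
  rw [h]
  exact continuous_finsetSum _ fun i _ =>
    (continuous_const_smul (w i)).comp (ContinuousMap.continuous_precomp _)

/-- The operator `g ↦ ∑ q, g ∘ Y q`. -/
noncomputable def superpose {X ι : Type*} [TopologicalSpace X] [CompactSpace X] [Fintype ι]
    (Y : ι → C(X, ℝ)) : (ℝ →ᵇ ℝ) →L[ℝ] C(X, ℝ) :=
  LinearMap.mkContinuous
    { toFun := fun g => ∑ q, g.toContinuousMap.comp (Y q)
      map_add' := fun g h => by ext x; simp [Finset.sum_add_distrib]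
      map_smul' := fun c g => by ext x; simp [Finset.mul_sum] }
    (Fintype.card ι) fun g => by
      rw [ContinuousMap.norm_le _ (by positivity)]
      intro x
      simp only [LinearMap.coe_mk, AddHom.coe_mk, ContinuousMap.sum_apply,
        ContinuousMap.comp_apply]
      refine (norm_sum_le_of_le _ fun q _ => g.norm_coe_le_norm (Y q x)).trans_eq ?_
      simp

theorem superpose_eq_sum {X ι : Type*} [TopologicalSpace X] [CompactSpace X] [Fintype ι]
    (Y : ι → C(X, ℝ)) (g : ℝ →ᵇ ℝ) : superpose Y g = ∑ q, g.toContinuousMap.comp (Y q) := rfl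

theorem superpose_apply {X ι : Type*} [TopologicalSpace X] [CompactSpace X] [Fintype ι]
    (Y : ι → C(X, ℝ)) (g : ℝ →ᵇ ℝ) (x : X) : superpose Y g x = ∑ q, g (Y q x) := by
  simp [superpose_eq_sum]

/-- If all but `d` of the `m` summands `c q` are close to `a / m`, then `∑ q, c q` approximates
`a` with an error of about `2 d / m`. -/
theorem abs_sub_sum_le {m d : ℕ} (hm : 1 ≤ m) {a M η : ℝ} (hη : 0 ≤ η) (ha : |a| ≤ M)
    {c : Fin m → ℝ} (hc : ∀ q, |c q| ≤ M / m) (B : Finset (Fin m)) (hB : B.card ≤ d)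
    (hgood : ∀ q ∉ B, |a / m - c q| ≤ η / m) : |a - ∑ q, c q| ≤ 2 * d / m * M + η := by
  have hm' : (0 : ℝ) < m := by exact_mod_cast hm
  have hM : 0 ≤ M := (abs_nonneg a).trans ha
  have h1 : a - ∑ q, c q = ∑ q, (a / m - c q) := by
    rw [Finset.sum_sub_distrib, Finset.sum_const, Finset.card_univ, Fintype.card_fin, nsmul_eq_mul]
    field_simp
  have h2 : ∀ q, |a / m - c q| ≤ (if q ∈ B then 2 * M / m else 0) + η / m := by
    intro q
    split_ifs with hq
    · have e : |a / m| ≤ M / m := by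
        rw [abs_div, abs_of_pos hm']
        gcongr
      have := abs_sub (a / m) (c q)
      have : 0 ≤ η / m := by positivity
      have : 2 * M / m = M / m + M / m := by ring
      linarith [hc q]
    · rw [zero_add]
      exact hgood q hq
  rw [h1]
  refine (Finset.abs_sum_le_sum_abs _ _).trans ((Finset.sum_le_sum fun q _ => h2 q).trans ?_)
  rw [Finset.sum_add_distrib, Finset.sum_ite_mem, Finset.univ_inter, Finset.sum_const,
    Finset.sum_const, Finset.card_univ, Fintype.card_fin, nsmul_eq_mul, nsmul_eq_mul,
    mul_div_cancel₀ _ hm'.ne']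
  have : (B.card : ℝ) ≤ d := by exact_mod_cast hB
  calc (B.card : ℝ) * (2 * M / m) + η ≤ d * (2 * M / m) + η := by gcongr
    _ = _ := by ring

/-- Each coordinate excludes at most one $q$, since $0,\dots,m-1$ are distinct modulo $m$. -/
theorem card_filter_exists_dvd_le {m d : ℕ} (k : Fin d → ℤ) :
    (Finset.univ.filter fun q : Fin m => ∃ i, (m : ℤ) ∣ k i - (q : ℕ)).card ≤ d := by
  classical
  have hsub : (Finset.univ.filter fun q : Fin m => ∃ i, (m : ℤ) ∣ k i - (q : ℕ)) ⊆
      Finset.univ.biUnion fun i => Finset.univ.filter fun q : Fin m => (m : ℤ) ∣ k i - (q : ℕ) := by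
    intro q
    simp
  refine (Finset.card_le_card hsub).trans (Finset.card_biUnion_le.trans ?_)
  calc _ ≤ ∑ _i : Fin d, 1 := Finset.sum_le_sum fun i _ => ?_
    _ = d := by simp
  refine Finset.card_le_one.2 fun a ha b hb => ?_
  simp only [Finset.mem_filter, Finset.mem_univ, true_and] at ha hb
  have h := dvd_sub ha hb
  have hlt := Int.eq_zero_of_abs_lt_dvd h (by rw [abs_lt]; omega)
  exact Fin.ext (by omega)

/-- Rational linear independence of the weights separates the values of weighted sums of positive
rational numbers. -/
theorem injective_sum_mul {m d : ℕ} (hd : 1 ≤ d) {κ : Type*} {w : Fin m → Fin d → ℝ}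
    (hw : LinearIndependent ℚ fun p : Fin m × Fin d => w p.1 p.2) {ρ : Fin m → κ → ℝ}
    (hρ : ∀ q k, ρ q k ∈ Set.range ((↑) : ℚ → ℝ)) (hpos : ∀ q k, 0 < ρ q k)
    (hinj : ∀ q, Function.Injective (ρ q)) :
    Function.Injective fun p : Fin m × (Fin d → κ) => ∑ i, w p.1 i * ρ p.1 (p.2 i) := by
  classical
  choose r hr using hρ
  rintro ⟨q, p⟩ ⟨q', p'⟩ h
  simp only at h
  have key : ∀ x : Fin m × Fin d, (if x.1 = q then r q (p x.2) else 0) -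
      (if x.1 = q' then r q' (p' x.2) else 0) = 0 := by
    refine Fintype.linearIndependent_iff.1 hw _ ?_
    rw [Fintype.sum_prod_type_right]
    rw [← sub_eq_zero, ← Finset.sum_sub_distrib] at h
    rw [← h]
    refine Finset.sum_congr rfl fun i _ => ?_
    simp only [sub_smul, ite_smul, zero_smul, Finset.sum_sub_distrib, Finset.sum_ite_eq',
      Finset.mem_univ, if_true, Rat.smul_def, hr]
    rw [mul_comm, mul_comm (ρ q' _)]
  -- Otherwise a positive coefficient in row $q$ would have nothing to cancel it.
  have hq : q = q' := by
    by_contra hne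
    have e := key (q, ⟨0, hd⟩)
    simp only [if_true, if_neg hne, sub_zero] at e
    have := hpos q (p ⟨0, hd⟩)
    rw [← hr, e] at this
    simp at this
  subst hq
  refine Prod.ext rfl (funext fun i => hinj q ?_)
  have e := key (q, i)
  simp only [if_true, sub_eq_zero] at e
  rw [← hr, ← hr]
  exact congrArg _ e

/-- Admissible inner functions can be perturbed so that a given `f` is approximated by a
superposition with relative error about `2 d / m`. -/
theorem exists_isAdmissible_superpose {m d : ℕ} (hm : 1 ≤ m) (hd : 1 ≤ d) {α : ℝ≥0} (hα0 : 0 < α)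
    (hα1 : α < 1) {w : Fin m → Fin d → ℝ}
    (hw : LinearIndependent ℚ fun p : Fin m × Fin d => w p.1 p.2) {χ : Fin m → C(I, ℝ)}
    (hχ : ∀ q, IsAdmissible α (χ q)) {ε : ℝ} (hε : 0 < ε) (f : C(Fin d → I, ℝ)) {η : ℝ}
    (hη : 0 < η) :
    ∃ ψ : Fin m → C(I, ℝ), (∀ q, IsAdmissible α (ψ q)) ∧ dist ψ χ ≤ ε ∧
      ∃ g : ℝ →ᵇ ℝ, ‖g‖ ≤ ‖f‖ / m ∧
        ‖f - superpose (fun q => weightedSum (w q) (ψ q)) g‖ ≤ 2 * d / m * ‖f‖ + η := by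
  have hm' : (0 : ℝ) < m := by exact_mod_cast hm
  -- Tilting makes the grid values positive and distinct, as separation requires; it uses up half of
  -- $\epsilon$, flattening the other half.
  obtain ⟨t, ht0, ht⟩ := exists_rat_btwn (show (0 : ℝ) < min (ε / 2) 1 by positivity)
  have ht1 : (t : ℝ) ≤ 1 := ht.le.trans (min_le_right _ _)
  have htε : (t : ℝ) ≤ ε / 2 := ht.le.trans (min_le_left _ _)
  have hχ' : ∀ q, IsAdmissible α (tilt t (χ q)) := fun q =>
    (hχ q).tilt_rat hα1 (by exact_mod_cast ht0) (by exact_mod_cast ht1)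
  obtain ⟨δ, hδ0, hδ⟩ := Metric.uniformContinuous_iff.1
    (CompactSpace.uniformContinuous_of_continuous f.continuous) η hη
  have hunif : ∀ q, ∃ δ' > 0, ∀ x y : I, dist x y < δ' →
      dist (tilt t (χ q) x) (tilt t (χ q) y) < ε / 2 := fun q => by
    obtain ⟨δ', h0, h⟩ := Metric.uniformContinuous_iff.1
      (CompactSpace.uniformContinuous_of_continuous (tilt t (χ q)).continuous) (ε / 2) (half_pos hε)
    exact ⟨δ', h0, fun x y => @h x y⟩
  choose δ' hδ'0 hδ' using hunif
  have hsmall : ∀ c : ℝ, 0 < c → ∀ᶠ N : ℕ in Filter.atTop, 1 / (N : ℝ) < c := fun c hc =>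
    tendsto_one_div_atTop_nhds_zero_nat.eventually (gt_mem_nhds hc)
  obtain ⟨N, hN1, hNδ, hNδ', hNadm⟩ := ((Filter.eventually_ge_atTop 1).and ((hsmall δ hδ0).and
    ((Filter.eventually_all.2 fun q => hsmall (δ' q) (hδ'0 q)).and
      (Filter.eventually_all.2 fun q => (hχ' q).eventually_comp hα0 hα1 hm)))).exists
  have hN' : (0 : ℝ) < N := by exact_mod_cast hN1
  let H : Fin m → C(I, I) := fun q => ⟨staircaseMap m N q, continuous_staircaseMap hm hN1⟩
  have hH : ∀ q x, dist (H q x) x ≤ 1 / N := fun q x =>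
    abs_staircaseMap_sub_self_le hN1 q.2 x
  let grid : Fin (N + 1) → I := fun j =>
    ⟨j / N, by positivity, (div_le_one hN').2 (by exact_mod_cast Nat.lt_succ_iff.1 j.2)⟩
  have hgrid : Function.Injective grid := by
    intro j k hjk
    have e : (j : ℝ) / N = k / N := congrArg Subtype.val hjk
    rw [div_left_inj' hN'.ne'] at e
    exact Fin.ext (by exact_mod_cast e)
  obtain ⟨g, hg, hgv⟩ := exists_boundedContinuousFunction_eq_of_injective
    (injective_sum_mul hd hw (ρ := fun q j => tilt t (χ q) (grid j))
      (fun q j => (hχ' q).rat _ ⟨j / N, by simp [grid]⟩)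
      (fun q j => (hχ q).tilt_pos ht0 ht1 _)
      (fun q => ((hχ q).strictMono_tilt ht0 ht1).injective.comp hgrid))
    (fun p => f (fun i => grid (p.2 i)) / m) (M := ‖f‖ / m) (by positivity)
    (fun p => by
      rw [abs_div, abs_of_pos hm']
      gcongr
      exact f.norm_coe_le_norm _)
  refine ⟨fun q => (tilt t (χ q)).comp (H q), fun q => hNadm q q (H q) q.2 rfl, ?_, g, hg, ?_⟩
  · refine (dist_pi_le_iff hε.le).2 fun q => ?_
    have h1 : dist ((tilt t (χ q)).comp (H q)) (tilt t (χ q)) ≤ ε / 2 :=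
      (ContinuousMap.dist_le (half_pos hε).le).2 fun x =>
        (hδ' q _ _ ((hH q x).trans_lt (hNδ' q))).le
    have h2 := (hχ q).dist_tilt_le ht0.le
    linarith [dist_triangle ((tilt t (χ q)).comp (H q)) (tilt t (χ q)) (χ q)]
  · rw [ContinuousMap.norm_le _ (by positivity)]
    intro x
    rw [ContinuousMap.sub_apply, superpose_apply]
    refine abs_sub_sum_le hm hη.le (f.norm_coe_le_norm x)
      (fun q => (g.norm_coe_le_norm _).trans hg) _
      (card_filter_exists_dvd_le fun i => ⌊(m : ℝ) * N * x i⌋) fun q hq => ?_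
    simp only [Finset.mem_filter, Finset.mem_univ, true_and, not_exists] at hq
    choose j hj using fun i => staircaseMap_mem_grid hm hN1 (x i) (hq i)
    have hHx : (fun i => H q (x i)) = fun i => grid (j i) :=
      funext fun i => Subtype.ext (hj i)
    have hval : g (weightedSum (w q) ((tilt t (χ q)).comp (H q)) x) =
        f (fun i => H q (x i)) / m := by
      rw [hHx, ← hgv (q, j), weightedSum_apply]
      congr 1
      refine Finset.sum_congr rfl fun i _ => ?_
      rw [ContinuousMap.comp_apply, show H q (x i) = grid (j i) from congrFun hHx i]
    rw [hval, ← sub_div, abs_div, abs_of_pos hm']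
    gcongr
    refine (hδ ?_).le
    rw [dist_comm]
    exact ((dist_pi_le_iff (by positivity)).2 fun i => hH q (x i)).trans_lt hNδ

/-! ### The Baire category argument. -/

/-- The set of tuples `ψ` for which some outer function bounded by `‖f‖ / m` approximates `f` with
relative error below about `2 d / m`. -/
def goodTuples {m d : ℕ} (w : Fin m → Fin d → ℝ) (f : C(Fin d → I, ℝ)) (η : ℝ) :
    Set (Fin m → C(I, ℝ)) :=
  {ψ | ∃ g : ℝ →ᵇ ℝ, ‖g‖ ≤ ‖f‖ / m ∧
    ‖f - superpose (fun q => weightedSum (w q) (ψ q)) g‖ < 2 * d / m * ‖f‖ + η}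

/-- For each fixed $g$ the error depends continuously on $\psi$; the set is a union over $g$. -/
theorem isOpen_goodTuples {m d : ℕ} (w : Fin m → Fin d → ℝ) (f : C(Fin d → I, ℝ)) (η : ℝ) :
    IsOpen (goodTuples w f η) := by
  have h : goodTuples w f η = ⋃ g : {g : ℝ →ᵇ ℝ // ‖g‖ ≤ ‖f‖ / m},
      {ψ | ‖f - superpose (fun q => weightedSum (w q) (ψ q)) g.1‖ < 2 * d / m * ‖f‖ + η} := by
    ext ψ
    simp [goodTuples]
  rw [h]
  refine isOpen_iUnion fun g => isOpen_lt (continuous_const.sub ?_).norm continuous_const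
  simp only [superpose_eq_sum]
  exact continuous_finsetSum _ fun q _ => (ContinuousMap.continuous_postcomp _).comp
    ((continuous_weightedSum (w q)).comp (continuous_apply q))

theorem exists_strictMono_approx_superpose {m d : ℕ} (hm : 1 ≤ m) (hd : 1 ≤ d) {α : ℝ≥0} (hα0 : 0 < α)
    (hα1 : α < 1) {w : Fin m → Fin d → ℝ}
    (hw : LinearIndependent ℚ fun p : Fin m × Fin d => w p.1 p.2) :
    ∃ ψ : Fin m → C(I, ℝ), (∀ q, StrictMono (ψ q)) ∧ (∀ q x, ψ q x ∈ Set.Icc (0 : ℝ) 1) ∧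
      (∀ q (x y : I), |ψ q x - ψ q y| ≤ |(x : ℝ) - y| ^ (α : ℝ)) ∧
      ∀ f η, 0 < η → ∃ g : ℝ →ᵇ ℝ, ‖g‖ ≤ ‖f‖ / m + η ∧
        ‖f - superpose (fun q => weightedSum (w q) (ψ q)) g‖ ≤ 2 * d / m * ‖f‖ + η := by
  let S : Set (Fin m → C(I, ℝ)) := {ψ | ∀ q, IsAdmissible α (ψ q)}
  have hev : ∀ q (x : I), Continuous fun ψ : Fin m → C(I, ℝ) => ψ q x := fun q x =>
    (continuous_eval_const x).comp (continuous_apply q)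
  let F := TopologicalSpace.denseSeq C(Fin d → I, ℝ)
  let U : (ℕ × ℕ) ⊕ {p : Fin m × ℚ × ℚ // p.2.1 < p.2.2 ∧ 0 ≤ p.2.1 ∧ p.2.2 ≤ 1} →
      Set (Fin m → C(I, ℝ)) :=
    Sum.elim (fun p => goodTuples w (F p.1) (1 / (p.2 + 1)))
      (fun p => {ψ | ψ p.1.1 (Set.projIcc 0 1 zero_le_one p.1.2.1) <
        ψ p.1.1 (Set.projIcc 0 1 zero_le_one p.1.2.2)})
  obtain ⟨ψ, hψ, hψU⟩ := exists_mem_closure_inter_of_isOpen (S := S) (U := U)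
    ⟨0, fun q => isAdmissible_zero α⟩ (by
      rintro (p | p)
      · exact isOpen_goodTuples _ _ _
      · exact isOpen_lt (hev _ _) (hev _ _))
    (by
      rintro (p | ⟨⟨q, a, b⟩, hab, ha, hb⟩) χ hχ <;> refine Metric.mem_closure_iff.2 fun ε hε => ?_
      · have hη : (0 : ℝ) < 1 / (p.2 + 1) := by positivity
        obtain ⟨ψ, h1, h2, g, h3, h4⟩ := exists_isAdmissible_superpose hm hd hα0 hα1 hw hχ
          (half_pos hε) (F p.1) (half_pos hη)
        refine ⟨ψ, ⟨h1, g, h3, h4.trans_lt ?_⟩, ?_⟩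
        · linarith
        · rw [dist_comm]
          linarith
      · obtain ⟨t, ht0, ht⟩ := exists_rat_btwn (show (0 : ℝ) < min (ε / 2) 1 by positivity)
        have ht1 : (t : ℝ) ≤ 1 := ht.le.trans (min_le_right _ _)
        have htε : (t : ℝ) ≤ ε / 2 := ht.le.trans (min_le_left _ _)
        refine ⟨fun q => tilt t (χ q), ⟨fun q => (hχ q).tilt_rat hα1 (by exact_mod_cast ht0)
          (by exact_mod_cast ht1), (hχ q).strictMono_tilt ht0 ht1 ?_⟩, ?_⟩
        · have ha' : (0 : ℝ) ≤ a := by exact_mod_cast ha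
          have hb' : (b : ℝ) ≤ 1 := by exact_mod_cast hb
          have hab' : (a : ℝ) < b := by exact_mod_cast hab
          exact Set.strictMonoOn_projIcc zero_le_one ⟨ha', by linarith⟩ ⟨by linarith, hb'⟩ hab'
        · rw [dist_comm]
          have : dist (fun q => tilt t (χ q)) χ ≤ t :=
            (dist_pi_le_iff ht0.le).2 fun q => (hχ q).dist_tilt_le ht0.le
          linarith)
  -- Weak inequalities pass to the closure of `S`; strictness comes from the rational pairs in `U`.
  have hmono : ∀ q, Monotone (ψ q) := by
    intro q x y hxy
    have hcl : IsClosed {ψ : Fin m → C(I, ℝ) | ψ q x ≤ ψ q y} := isClosed_le (hev q x) (hev q y)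
    have hsub : S ⊆ {ψ | ψ q x ≤ ψ q y} := fun χ hχ => (hχ q).mono hxy
    exact closure_minimal hsub hcl hψ
  refine ⟨ψ, fun q x y hxy => ?_, fun q x => ?_, fun q x y => ?_, fun f η hη => ?_⟩
  · have hxy' : (x : ℝ) < y := hxy
    obtain ⟨a, hxa, hay⟩ := exists_rat_btwn hxy'
    obtain ⟨b, hab, hby⟩ := exists_rat_btwn hay
    have ha : (0 : ℝ) ≤ a := x.2.1.trans hxa.le
    have hb : (b : ℝ) ≤ 1 := hby.le.trans y.2.2
    have h := hψU (.inr ⟨(q, a, b), by exact_mod_cast hab, by exact_mod_cast ha,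
      by exact_mod_cast hb⟩)
    have h1 : x ≤ Set.projIcc 0 1 zero_le_one (a : ℝ) := by
      rw [Set.projIcc_of_mem _ ⟨ha, by linarith⟩]
      exact hxa.le
    have h2 : Set.projIcc 0 1 zero_le_one (b : ℝ) ≤ y := by
      rw [Set.projIcc_of_mem _ ⟨by linarith, hb⟩]
      exact hby.le
    exact (hmono q h1).trans_lt (lt_of_lt_of_le h (hmono q h2))
  · have hsub : S ⊆ (fun ψ => ψ q x) ⁻¹' Set.Icc (0 : ℝ) 1 := fun χ hχ => (hχ q).mem_Icc x
    exact closure_minimal hsub (isClosed_Icc.preimage (hev q x)) hψ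
  · have hcl : IsClosed {ψ : Fin m → C(I, ℝ) | |ψ q x - ψ q y| ≤ |(x : ℝ) - y| ^ (α : ℝ)} :=
      isClosed_le ((hev q x).sub (hev q y)).abs continuous_const
    refine closure_minimal (fun χ hχ => ?_) hcl hψ
    obtain ⟨C, _, hC1, hC⟩ := (hχ q).holder
    exact (hC x y).trans (mul_le_of_le_one_left (by positivity) hC1.le)
  · have hm' : (1 : ℝ) ≤ m := by exact_mod_cast hm
    set c : ℝ := 2 * d / m with hc
    have hc0 : 0 ≤ c := by positivity
    -- Replacing $F_n$ by $f$ costs $(c+1)\|f-F_n\|\le\eta/2$; the tolerance $1/(k+1)$ takes the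
    -- other half.
    obtain ⟨n, hn⟩ := (TopologicalSpace.denseRange_denseSeq C(Fin d → I, ℝ)).exists_dist_lt f
      (show 0 < η / (2 * (c + 1)) by positivity)
    obtain ⟨k, hk⟩ := exists_nat_one_div_lt (half_pos hη)
    obtain ⟨g, hg, hfg⟩ := hψU (.inl (n, k))
    have hd1 : (c + 1) * ‖f - F n‖ ≤ η / 2 := by
      rw [dist_eq_norm] at hn
      have := mul_le_mul_of_nonneg_left hn.le (show 0 ≤ c + 1 by positivity)
      refine this.trans_eq ?_
      field_simp
    have hd2 : ‖f - F n‖ ≤ η := by nlinarith [norm_nonneg (f - F n)]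
    have hFn : ‖F n‖ ≤ ‖f‖ + ‖f - F n‖ := by
      have := norm_sub_le f (f - F n)
      rwa [sub_sub_cancel] at this
    refine ⟨g, hg.trans ?_, ?_⟩
    · calc ‖F n‖ / m ≤ (‖f‖ + ‖f - F n‖) / m := by gcongr
        _ = ‖f‖ / m + ‖f - F n‖ / m := add_div _ _ _
        _ ≤ ‖f‖ / m + η := by
          gcongr
          exact (div_le_self (norm_nonneg _) hm').trans hd2
    · have h1 := norm_sub_le_norm_sub_add_norm_sub f (F n)
        (superpose (fun q => weightedSum (w q) (ψ q)) g)
      have h2 : c * ‖F n‖ ≤ c * (‖f‖ + ‖f - F n‖) := by gcongr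
      simp only [← hc] at hfg
      linarith

/-! ### Existence of a Kolmogorov system and the theorem. -/

/-- Kolmogorov's superposition theorem with Hölder continuous inner functions. -/
theorem exists_isKolmogorovSystem {d : ℕ} (hd : 1 ≤ d) {α : ℝ≥0} (hα0 : 0 < α) (hα1 : α < 1) :
    ∃ (lam : Fin d → ℝ) (φ : Fin (2 * d + 1) → C(I, I)), IsKolmogorovSystem α lam φ := by
  obtain ⟨μ, lam, hμ, hlam, hind⟩ := exists_linearIndependent_mul (2 * d + 1) d
  obtain ⟨ψ, hmono, hmem, hholder, happrox⟩ := exists_strictMono_approx_superpose (m := 2 * d + 1) (by omega) hd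
    hα0 hα1 (w := fun q i => μ q * lam i) hind
  have hd' : (1 : ℝ) ≤ d := by exact_mod_cast hd
  have hsurj : Function.Surjective
      (superpose fun q => weightedSum (fun i => μ q * lam i) (ψ q)) := by
    -- Here $\theta=\frac{2d}{2d+1}+\frac1{4d+2}$, the second term being the slack $\eta/\|f\|$.
    refine ContinuousLinearMap.surjective_of_approx _ (θ := (4 * d + 1) / (4 * d + 2))
      (by positivity) ((div_lt_one (by positivity)).2 (by linarith)) fun f => ?_
    rcases eq_or_ne f 0 with rfl | hf
    · exact ⟨0, by simp⟩
    have hf' : 0 < ‖f‖ := norm_pos_iff.2 hf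
    obtain ⟨g, hg, hfg⟩ := happrox f (1 / (4 * d + 2) * ‖f‖) (by positivity)
    refine ⟨g, hg.trans ?_, hfg.trans_eq ?_⟩
    · push_cast
      have h1 : ‖f‖ / (2 * d + 1) + 1 / (4 * d + 2) * ‖f‖ = 3 / (4 * d + 2) * ‖f‖ := by
        field_simp
        ring
      rw [h1]
      exact mul_le_of_le_one_left hf'.le ((div_le_one (by positivity)).2 (by linarith))
    · push_cast
      field_simp
      ring
  -- Taking $\phi_q=\mu_q\psi_q$ leaves coefficients $\lambda_i$ independent of $q$.
  refine ⟨lam, fun q => ⟨fun x => ⟨μ q * ψ q x, mul_nonneg (hμ q).1.le (hmem q x).1,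
    mul_le_one₀ (hμ q).2 (hmem q x).1 (hmem q x).2⟩, by fun_prop⟩, fun i => (hlam i).1,
    fun i => (hlam i).2, fun q x y hxy => ?_, fun q => ⟨1, fun x y => ?_⟩, fun f => ?_⟩
  · exact mul_lt_mul_of_pos_left (hmono q hxy) (hμ q).1
  · rw [edist_nndist, edist_nndist, ← ENNReal.coe_rpow_of_nonneg _ α.coe_nonneg, ← ENNReal.coe_mul,
      ENNReal.coe_le_coe, ← NNReal.coe_le_coe]
    push_cast
    rw [one_mul]
    change |μ q * ψ q x - μ q * ψ q y| ≤ |(x : ℝ) - y| ^ (α : ℝ)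
    rw [← mul_sub, abs_mul, abs_of_pos (hμ q).1]
    exact (mul_le_of_le_one_left (abs_nonneg _) (hμ q).2).trans (hholder q x y)
  · obtain ⟨g, rfl⟩ := hsurj f
    refine ⟨g, g.continuous.continuousOn, fun x => ?_⟩
    rw [superpose_apply]
    refine Finset.sum_congr rfl fun q _ => congrArg g ?_
    rw [weightedSum_apply]
    exact Finset.sum_congr rfl fun i _ => by
      change _ = lam i * (μ q * ψ q (x i))
      ring

theorem mainTheorem2 (d : ℕ) (hd : 1 ≤ d) (α : ℝ≥0) (hα0 : 0 < α) (hα1 : α < 1) :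
    (∃ (lam : Fin d → ℝ) (φ : Fin (2 * d + 1) → C(I, I)), IsKolmogorovSystem α lam φ) ∧
    ∀ (lam : Fin d → ℝ) (φ : Fin (2 * d + 1) → C(I, I)), IsKolmogorovSystem α lam φ →
      ∀ (f : C(Fin d → I, ℝ)) (ε : ℝ), 0 < ε →
        ∃ K ∈ Submodule.span ℝ (Set.range (kolmogorovMonomial lam φ)), ‖f - K‖ ≤ ε :=
  ⟨exists_isKolmogorovSystem hd hα0 hα1,
    fun _ _ h f _ hε => exists_mem_span_kolmogorovMonomial h f hε⟩
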